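/- Let $A=\{0,1\}$, let $\varphi:A^*\to A^*$ be the Thue--Morse morphism $\varphi(0)=01$, $\varphi(1)=10$, and let $\mathbf t=011010011001\cdots$ be the Thue--Morse word, i.e. the fixed point of $\varphi$ starting with $0$, with letters indexed from $0$. For a letter $a$, let $\bar a$ denote the other letter. For words $w,x$, let $\binom{w}{x}$ be the number of occurrences of $x$ as a (scattered) subsequence of $w$. Words $u,v$ are *$k$-binomially equivalent*, $u\sim_k v$, if $\binom ux=\binom vx$ for all words $x$ over $A$ with $|x|\le k$. For a factor $u$ of $\mathbf t$, a *cutting set of order $k$* of $u$ is a non-empty set of the form $C=\{j : 0\le j\le |u|,\ i+j\in 2^k\mathbb N\}$, where $i\ge 0$ is such that $u=\mathbf t_{[i,i+|u|)}$. The *factorization of order $k$ of $u$ associated with $C$* is the pair $(p,s)$ such that $|p|=\min C$, $|s|=|u|-\max C$ and $u=p\,\varphi^k(w)\,s$ for some word $w$, where $p$ is empty or a proper suffix of $\varphi^k(a)$ for a letter $a$, and $s$ is empty or a proper prefix of $\varphi^k(b)$ for a letter $b$. If $|u|\ge 2^k-1$, the word $u$ has at least one factorization of order $k$, and $(p_u,s_u)$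 denotes the unique one for which $|p_u|$ is minimal. Two pairs $(p_1,s_1)$, $(p_2,s_2)$ of words of length less than $2^k$ satisfy $(p_1,s_1)\equiv_k(p_2,s_2)$ if there is a letter $a\in A$ such that one of the following holds: 1. $|p_1|+|s_1|=|p_2|+|s_2|$ and at least one of (a) $(p_1,s_1)=(p_2,s_2)$; (b) $(p_1,\varphi^{k-1}(a)s_1)=(p_2\varphi^{k-1}(a),s_2)$; (c) $(p_2,\varphi^{k-1}(a)s_2)=(p_1\varphi^{k-1}(a),s_1)$; (d) $(p_1,s_1)=(s_2,p_2)=(\varphi^{k-1}(a),\varphi^{k-1}(\bar a))$; 2. $\bigl||p_1|+|s_1|-(|p_2|+|s_2|)\bigr|=2^k$ and at least one of (a) $(p_1,s_1)=(p_2\varphi^{k-1}(a),\varphi^{k-1}(\bar a)s_2)$; (b) $(p_2,s_2)=(p_1\varphi^{k-1}(a),\varphi^{k-1}(\bar a)s_1)$. **Theorem.** Let $k\ge 3$ and let $u,v$ be factors of $\mathbf t$ of the same length $n\ge 2^k-1$. Then $(p_u,s_u)$ and $(p_v,s_v)$ are well defined, and $$u\sim_k v \iff (p_u,s_u)\equiv_k(p_v,s_v).$$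 -/

import Mathlib

namespace ThueMorse

/-- Finite words over the alphabet `{0, 1}`; `false` is the letter `0`, `true` is the letter `1`. -/
abbrev Word := List Bool

/-- The Thue–Morse morphism `0 ↦ 01`, `1 ↦ 10`. -/
def φ (w : Word) : Word := w.flatMap fun a => [a, !a]

/-- The (0-indexed) letters of the Thue–Morse word `t`, the fixed point of `φ` starting with `0`:
the words `φ^n(0)`, of length `2^n > n`, are prefixes of one another, and `t` is their limit. -/
def t (n : ℕ) : Bool := (φ^[n] [false]).getD n false

/-- The word `t_{[i, i+n)}`. -/
def tFactor (i n : ℕ) : Word := (List.range n).map fun j => t (i + j)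

/-- The set of factors of length `n` of the Thue–Morse word. -/
def Fac (n : ℕ) : Set Word := {u | ∃ i, u = tFactor i n}

/-- The binomial coefficient of words: the number of occurrences of `x` as a subsequence of `u`
(`List.sublists` lists the subsequences of `u` with multiplicity, one for each set of positions). -/
def binom (u x : Word) : ℕ := u.sublists.count x

/-- `k`-binomial equivalence. -/
def BinomEquiv (k : ℕ) (u v : Word) : Prop :=
  ∀ x : Word, x.length ≤ k → binom u x = binom v x

/-- The position of the `n`-th cutting bar of order `k`. -/
def bar (k n : ℕ) : ℕ := (φ^[k] (tFactor 0 n)).length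

/-- The set of cutting sets of order `k` of `u`: for each occurrence `u = t_{[i, i+|u|)}`, the set
`([i, i+|u|] ∩ bar_k(ℕ)) - i`, provided that it is non-empty. -/
def Cut (k : ℕ) (u : Word) : Set (Set ℕ) :=
  {C | C.Nonempty ∧ ∃ i, u = tFactor i u.length ∧
    C = {j | j ≤ u.length ∧ i + j ∈ Set.range (bar k)}}

/-- `q = (p, s)` is the factorization of `u` associated with the cutting set `C` of order `k`:
`u = p φ^k(v) s`, where `p` ends at the first and `s` starts at the last cutting bar. -/
def IsFactorizationOf (k : ℕ) (u : Word) (C : Set ℕ) (q : Word × Word) : Prop :=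
  IsLeast C q.1.length ∧
  (∃ m, IsGreatest C m ∧ m + q.2.length = u.length) ∧
  (∃ v : Word, u = q.1 ++ φ^[k] v ++ q.2) ∧
  (q.1 = [] ∨ ∃ a : Bool, q.1 <:+ φ^[k] [a] ∧ q.1 ≠ φ^[k] [a]) ∧
  (q.2 = [] ∨ ∃ b : Bool, q.2 <+: φ^[k] [b] ∧ q.2 ≠ φ^[k] [b])

/-- `q = (p, s)` is a factorization of order `k` of `u`. -/
def IsFactorization (k : ℕ) (u : Word) (q : Word × Word) : Prop :=
  ∃ C ∈ Cut k u, IsFactorizationOf k u C q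

/-- `q = (p_u, s_u)`: the factorization of order `k` of `u` for which `|p_u|` is minimal. -/
def IsMinFactorization (k : ℕ) (u : Word) (q : Word × Word) : Prop :=
  IsFactorization k u q ∧ ∀ q', IsFactorization k u q' → q.1.length ≤ q'.1.length

/-- The relation `≡_k` on pairs of words of length less than `2^k`. -/
def TypeEquiv (k : ℕ) (q₁ q₂ : Word × Word) : Prop :=
  (q₁.1.length < 2 ^ k ∧ q₁.2.length < 2 ^ k ∧ q₂.1.length < 2 ^ k ∧ q₂.2.length < 2 ^ k) ∧
  ∃ a : Bool,
    (q₁.1.length + q₁.2.length = q₂.1.length + q₂.2.length ∧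
      (q₁ = q₂ ∨
       (q₁.1, φ^[k - 1] [a] ++ q₁.2) = (q₂.1 ++ φ^[k - 1] [a], q₂.2) ∨
       (q₂.1, φ^[k - 1] [a] ++ q₂.2) = (q₁.1 ++ φ^[k - 1] [a], q₁.2) ∨
       (q₁ = (φ^[k - 1] [a], φ^[k - 1] [!a]) ∧ (q₂.2, q₂.1) = (φ^[k - 1] [a], φ^[k - 1] [!a])))) ∨
    (|((q₁.1.length + q₁.2.length : ℕ) : ℤ) - ((q₂.1.length + q₂.2.length : ℕ) : ℤ)| = 2 ^ k ∧
      (q₁ = (q₂.1 ++ φ^[k - 1] [a], φ^[k - 1] [!a] ++ q₂.2) ∨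
       q₂ = (q₁.1 ++ φ^[k - 1] [a], φ^[k - 1] [!a] ++ q₁.2)))

end ThueMorse

namespace ThueMorse
open Polynomial

/-! Sufficiency. The Magnus transform turns `k`-binomial equivalence into congruence modulo
noncommutative polynomials of order greater than `k`. A commutator computation
(`orderGE_magnus_φ_iterate_sub`) makes all blocks `φ^k(a)` congruent, and since `a(āa)^m = (aā)^m
a`, a half-block `φ^(k-1)(a)` slides past blocks (`binomEquiv_half_comm`). These moves realise every
case of `TypeEquiv`.

Necessity. It is enough to know `∑ ε(u_i) (1 + X)^i` modulo `X^k` (`BinomEquiv.X_pow_dvd`). Applying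
`φ` substitutes `z ↦ z^2` and multiplies by `1 - z`, so `φ^k` contributes exactly `X^k`; for two
words with the same outer parts, the coefficient of `X^k` then compares the balances of their block
words. One inducts on the order (`Occ.typeEquiv_of_dvd`). Once the types of order `k` are
equivalent, the next coefficient excludes every case but equality, because factors of `t` have
balance at most 2 in absolute value, `t` has no cube of a letter, and the words are long. With equal
cuts of order `k`, equal balances give equivalent types of order `k + 1` (`HalfOcc.typeEquiv`).

This works for any factorization; minimality of `|p_u|` only selects one. -/

/-! ### Blocks `φ^k(a)`: lengths and end letters. -/

@[simp] lemma φ_nil : φ [] = [] := rfl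

@[simp] lemma φ_cons (a : Bool) (w : Word) : φ (a :: w) = a :: (!a) :: φ w := rfl

lemma φ_append (u v : Word) : φ (u ++ v) = φ u ++ φ v := List.flatMap_append

lemma length_φ (w : Word) : (φ w).length = 2 * w.length := by
  induction w with
  | nil => rfl
  | cons a w ih => simp [ih]; ring

lemma φ_iterate_append (k : ℕ) (u v : Word) : φ^[k] (u ++ v) = φ^[k] u ++ φ^[k] v := by
  induction k generalizing u v with
  | zero => rfl
  | succ k ih => simp [Function.iterate_succ_apply, φ_append, ih]

@[simp] lemma φ_iterate_nil (k : ℕ) : φ^[k] [] = [] := by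
  induction k with
  | zero => rfl
  | succ k ih => simp [Function.iterate_succ_apply, ih]

@[simp] lemma length_φ_iterate (k : ℕ) (w : Word) : (φ^[k] w).length = 2 ^ k * w.length := by
  induction k generalizing w with
  | zero => simp
  | succ k ih => rw [Function.iterate_succ_apply, ih, length_φ]; ring

lemma φ_iterate_succ_singleton (k : ℕ) (a : Bool) :
    φ^[k + 1] [a] = φ^[k] [a] ++ φ^[k] [!a] := by
  rw [Function.iterate_succ_apply, ← φ_iterate_append]; rfl

lemma head_φ_iterate (k : ℕ) (a : Bool) : (φ^[k] [a]).head? = some a := by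
  induction k with
  | zero => rfl
  | succ k ih => rw [φ_iterate_succ_singleton, List.head?_append, ih]; rfl

/-- The block of order `k + 1` ends with the block of order `k` of the opposite letter, so the last
letter flips with each order. -/
lemma getLast_φ_iterate (k : ℕ) (a : Bool) :
    (φ^[k] [a]).getLast? = some (xor a (decide (k % 2 = 1))) := by
  induction k generalizing a with
  | zero => simp
  | succ k ih =>
    rw [φ_iterate_succ_singleton, List.getLast?_append, ih]
    rcases Nat.mod_two_eq_zero_or_one k with h | h <;> simp [Nat.succ_mod_two_eq_one_iff, h]

lemma φ_iterate_singleton_injective {k : ℕ} {a b : Bool} (h : φ^[k] [a] = φ^[k] [b]) : a = b := by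
  have := congrArg List.head? h
  simpa [head_φ_iterate] using this

/-- A nonempty prefix of `φ^k(a)` starts with `a`. -/
lemma eq_nil_or_head_of_prefix {k : ℕ} {a : Bool} {r : Word} (h : r <+: φ^[k] [a]) :
    r = [] ∨ r.head? = some a := by
  obtain ⟨y, hy⟩ := h
  cases r with
  | nil => exact Or.inl rfl
  | cons b r =>
    right
    have := head_φ_iterate k a
    rw [← hy] at this
    simpa using this

lemma eq_nil_or_getLast_of_suffix {k : ℕ} {a : Bool} {q : Word} (h : q <:+ φ^[k] [a]) :
    q = [] ∨ q.getLast? = some (xor a (decide (k % 2 = 1))) := by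
  obtain ⟨y, hy⟩ := h
  rcases List.eq_nil_or_concat q with rfl | ⟨q, b, rfl⟩
  · exact Or.inl rfl
  · right
    have := getLast_φ_iterate k a
    rw [← hy] at this
    simpa [List.getLast?_append] using this

lemma eq_nil_of_prefix_of_prefix {j k : ℕ} {a : Bool} {r : Word}
    (h₁ : r <+: φ^[j] [a]) (h₂ : r <+: φ^[k] [!a]) : r = [] := by
  rcases eq_nil_or_head_of_prefix h₁ with h | h
  · exact h
  rcases eq_nil_or_head_of_prefix h₂ with h' | h'
  · exact h'
  · rw [h] at h'; simp at h'

lemma eq_nil_of_suffix_of_suffix {j k : ℕ} {a b : Bool} {q : Word}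
    (h₁ : q <:+ φ^[j] [a]) (h₂ : q <:+ φ^[k] [b])
    (hab : xor a (decide (j % 2 = 1)) ≠ xor b (decide (k % 2 = 1))) : q = [] := by
  rcases eq_nil_or_getLast_of_suffix h₁ with h | h
  · exact h
  rcases eq_nil_or_getLast_of_suffix h₂ with h' | h'
  · exact h'
  · rw [h] at h'; exact absurd (Option.some.inj h') hab

/-! ### Letters and factors of `t`. -/

lemma getD_φ_even (w : Word) (n : ℕ) : (φ w).getD (2 * n) false = w.getD n false := by
  induction w generalizing n with
  | nil => simp
  | cons a w ih =>
    cases n with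
    | zero => simp
    | succ n => simpa [Nat.mul_succ] using ih n

lemma getD_φ_odd (w : Word) (n : ℕ) (hn : n < w.length) :
    (φ w).getD (2 * n + 1) false = !w.getD n false := by
  induction w generalizing n with
  | nil => simp at hn
  | cons a w ih =>
    cases n with
    | zero => simp
    | succ n =>
      have : n < w.length := by simpa using hn
      simpa [Nat.mul_succ] using ih n this

lemma getD_φ_iterate_of_le {j k n : ℕ} (hjk : j ≤ k) (hn : n < 2 ^ j) :
    (φ^[k] [false]).getD n false = (φ^[j] [false]).getD n false := by
  induction k, hjk using Nat.le_induction with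
  | base => rfl
  | succ k hk ih =>
    have : n < 2 ^ k := hn.trans_le (Nat.pow_le_pow_right (by norm_num) hk)
    rw [← ih, φ_iterate_succ_singleton, List.getD_append _ _ _ _ (by simpa using this)]

lemma t_eq_getD {k n : ℕ} (hn : n < 2 ^ k) : t n = (φ^[k] [false]).getD n false := by
  unfold t
  rcases le_total n k with h | h
  · exact (getD_φ_iterate_of_le h Nat.lt_two_pow_self).symm
  · exact getD_φ_iterate_of_le h hn

lemma t_two_mul (n : ℕ) : t (2 * n) = t n := by
  have h : n < 2 ^ n := Nat.lt_two_pow_self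
  rw [t_eq_getD (k := n + 1) (n := 2 * n) (by rw [pow_succ]; omega), Function.iterate_succ_apply',
    getD_φ_even, t_eq_getD h]

lemma t_two_mul_add_one (n : ℕ) : t (2 * n + 1) = !t n := by
  have h : n < 2 ^ n := Nat.lt_two_pow_self
  rw [t_eq_getD (k := n + 1) (n := 2 * n + 1) (by rw [pow_succ]; omega),
    Function.iterate_succ_apply', getD_φ_odd _ _ (by simpa using h), t_eq_getD h]

/-- The Thue–Morse word contains no cube of a letter. -/
lemma t_no_cube (a : Bool) (n : ℕ) (h₀ : t n = a) (h₁ : t (n + 1) = a) (h₂ : t (n + 2) = a) :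
    False := by
  -- Among three consecutive positions, two form an aligned pair `2j, 2j + 1`, which carries
  -- distinct letters.
  rcases Nat.even_or_odd' n with ⟨c, rfl | rfl⟩
  · rw [t_two_mul_add_one, ← t_two_mul, h₀] at h₁
    cases a <;> simp at h₁
  · rw [show 2 * c + 1 + 2 = 2 * (c + 1) + 1 by ring, t_two_mul_add_one, ← t_two_mul,
      show 2 * (c + 1) = 2 * c + 1 + 1 by ring, h₁] at h₂
    cases a <;> simp at h₂

@[simp] lemma length_tFactor (i n : ℕ) : (tFactor i n).length = n := by simp [tFactor]

@[simp] lemma tFactor_zero (i : ℕ) : tFactor i 0 = [] := rfl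

@[simp] lemma tFactor_one (i : ℕ) : tFactor i 1 = [t i] := rfl

lemma tFactor_add (i m n : ℕ) : tFactor i (m + n) = tFactor i m ++ tFactor (i + m) n := by
  simp [tFactor, List.range_add, add_assoc]

lemma tFactor_two (i : ℕ) : tFactor i 2 = [t i, t (i + 1)] := rfl

lemma φ_tFactor (c m : ℕ) : φ (tFactor c m) = tFactor (2 * c) (2 * m) := by
  induction m with
  | zero => rfl
  | succ m ih =>
    rw [tFactor_add, φ_append, ih, Nat.mul_succ, tFactor_add, ← Nat.mul_add, tFactor_two,
      t_two_mul_add_one, t_two_mul]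
    rfl

lemma φ_iterate_tFactor (k c m : ℕ) :
    φ^[k] (tFactor c m) = tFactor (2 ^ k * c) (2 ^ k * m) := by
  induction k generalizing c m with
  | zero => simp
  | succ k ih => rw [Function.iterate_succ_apply, φ_tFactor, ih]; ring_nf

lemma φ_iterate_letter (k c : ℕ) : φ^[k] [t c] = tFactor (2 ^ k * c) (2 ^ k) := by
  rw [← tFactor_one, φ_iterate_tFactor, mul_one]

lemma bar_eq (k n : ℕ) : bar k n = 2 ^ k * n := by simp [bar]

/-! ### The signed generating polynomial and the balance. -/

/-- The sign of a letter. -/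
def ε (a : Bool) : ℤ := if a then -1 else 1

lemma ε_not (a : Bool) : ε (!a) = -ε a := by cases a <;> rfl

/-- The polynomial `∑ ε(w_i) z^i`. -/
def pol {R : Type*} [CommRing R] (z : R) : Word → R
  | [] => 0
  | a :: w => (ε a : R) + z * pol z w

section
variable {R S : Type*} [CommRing R] [CommRing S]

@[simp] lemma pol_nil (z : R) : pol z [] = 0 := rfl

@[simp] lemma pol_cons (z : R) (a : Bool) (w : Word) :
    pol z (a :: w) = (ε a : R) + z * pol z w := rfl

lemma pol_append (z : R) (u v : Word) : pol z (u ++ v) = pol z u + z ^ u.length * pol z v := by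
  induction u with
  | nil => simp
  | cons a u ih => simp [ih]; ring

lemma pol_φ (z : R) (w : Word) : pol z (φ w) = (1 - z) * pol (z ^ 2) w := by
  induction w with
  | nil => simp
  | cons a w ih => simp [ih, ε_not]; ring

/-- The product `(1 - z)(1 - z^2)⋯(1 - z^(2^(k-1)))`. -/
def tmProd (z : R) (k : ℕ) : R := ∏ i ∈ Finset.range k, (1 - z ^ 2 ^ i)

lemma tmProd_succ (z : R) (k : ℕ) : tmProd z (k + 1) = tmProd z k * (1 - z ^ 2 ^ k) :=
  Finset.prod_range_succ _ _

lemma pol_φ_iterate (z : R) (k : ℕ) (w : Word) :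
    pol z (φ^[k] w) = tmProd z k * pol (z ^ 2 ^ k) w := by
  induction k generalizing w with
  | zero => simp [tmProd]
  | succ k ih =>
    rw [Function.iterate_succ_apply, ih, pol_φ, tmProd_succ, ← pow_mul, ← pow_succ]; ring

lemma map_pol (f : R →+* S) (z : R) (w : Word) : f (pol z w) = pol (f z) w := by
  induction w with
  | nil => simp
  | cons a w ih => simp [ih]

end

/-- The difference of the number of `0`s and the number of `1`s. -/
abbrev balance (w : Word) : ℤ := pol 1 w

lemma balance_append (u v : Word) : balance (u ++ v) = balance u + balance v := by
  simp [balance, pol_append]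

lemma balance_singleton (a : Bool) : balance [a] = ε a := by simp [balance]

lemma balance_tFactor_even (c m : ℕ) : balance (tFactor (2 * c) (2 * m)) = 0 := by
  rw [← φ_tFactor, balance, pol_φ]; simp

lemma abs_ε (a : Bool) : |ε a| = 1 := by cases a <;> rfl

lemma abs_balance_tFactor_zero (n : ℕ) : |balance (tFactor 0 n)| ≤ 1 := by
  rcases Nat.even_or_odd' n with ⟨m, rfl | rfl⟩
  · rw [← mul_zero 2, balance_tFactor_even]; simp
  · rw [tFactor_add, balance_append, ← mul_zero 2, balance_tFactor_even, tFactor_one,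
      balance_singleton, zero_add, abs_ε]

/-- A factor is the difference of two prefixes, each of balance at most 1 in absolute value. -/
lemma abs_balance_tFactor_le (c m : ℕ) : |balance (tFactor c m)| ≤ 2 := by
  have h := balance_append (tFactor 0 c) (tFactor (0 + c) m)
  rw [← tFactor_add, zero_add] at h
  have h₁ := abs_le.1 (abs_balance_tFactor_zero c)
  have h₂ := abs_le.1 (abs_balance_tFactor_zero (c + m))
  rw [abs_le]; constructor <;> linarith

/-! ### From binomial coefficients to the polynomial modulo `X^k`. -/

/-- The contribution of a subsequence to `pol (1 + X)`. -/
noncomputable def subseqWeight : Word → ℤ[X]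
  | [] => 0
  | a :: y => X * subseqWeight y + if y = [] then (ε a : ℤ[X]) else 0

lemma X_pow_dvd_subseqWeight (y : Word) (k : ℕ) (h : k < y.length) : X ^ k ∣ subseqWeight y := by
  induction y generalizing k with
  | nil => simp at h
  | cons a y ih =>
    cases k with
    | zero => simp
    | succ k =>
      have h' : k < y.length := by simpa using h
      have hy : y ≠ [] := by rintro rfl; simp at h'
      simp only [subseqWeight, if_neg hy, add_zero, pow_succ']
      exact mul_dvd_mul_left _ (ih k h')

/-- A nonempty `y` has weight `X^(|y|-1) ε(last y)`. Fixing the position `i` of the last letter and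
choosing the others freely among the `i` earlier ones gives `ε(w_i) (1 + X)^i`. -/
lemma sum_subseqWeight' (w : Word) :
    (w.sublists'.map subseqWeight).sum = pol (1 + X) w := by
  induction w with
  | nil => simp [subseqWeight]
  | cons a w ih =>
    -- Only the empty subsequence contributes, and it is listed once.
    have h : ∀ w : Word, (w.sublists'.map fun y => if y = [] then (ε a : ℤ[X]) else 0).sum
        = (ε a : ℤ[X]) := by
      intro w
      induction w with
      | nil => simp
      | cons b w ih =>
        rw [List.sublists'_cons, List.map_append, List.sum_append, ih, List.map_map]
        simp [Function.comp_def]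
    rw [List.sublists'_cons, List.map_append, List.sum_append, ih, List.map_map,
      show subseqWeight ∘ List.cons a = fun y => X * subseqWeight y +
        if y = [] then (ε a : ℤ[X]) else 0 from rfl, List.sum_map_add, List.sum_map_mul_left, ih, h,
      pol_cons]
    ring

lemma sum_subseqWeight (w : Word) :
    (w.sublists.map subseqWeight).sum = pol (1 + X) w := by
  rw [← sum_subseqWeight']
  exact ((List.sublists_perm_sublists' w).map _).sum_eq

/-- The index set `U` is left free so that two words can be summed over the same set and compared
termwise. -/
lemma sum_sublists_eq (w : Word) (U : Finset Word) (hU : w.sublists.toFinset ⊆ U) (g : Word → ℤ[X]) :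
    (w.sublists.map g).sum = ∑ x ∈ U, (binom w x : ℤ[X]) * g x := by
  have hb : ∀ x, @List.count _ instBEqOfDecidableEq x w.sublists = binom w x := by
    intro x
    unfold binom
    congr 1
    exact lawful_beq_subsingleton _ _
  rw [Finset.sum_list_map_count, Finset.sum_subset hU]
  · simp [hb]
  · intro x _ hx
    rw [hb, binom, List.count_eq_zero_of_not_mem (by simpa using hx), zero_smul]

/-- Binomially equivalent words have congruent polynomials. -/
theorem BinomEquiv.X_pow_dvd {k : ℕ} {u v : Word} (h : BinomEquiv k u v) :
    (X : ℤ[X]) ^ k ∣ pol (1 + X) u - pol (1 + X) v := by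
  rw [← sum_subseqWeight, ← sum_subseqWeight,
    sum_sublists_eq u _ Finset.subset_union_left, sum_sublists_eq v _ Finset.subset_union_right,
    ← Finset.sum_sub_distrib]
  refine Finset.dvd_sum fun x _ => ?_
  rcases le_or_gt x.length k with hx | hx
  · rw [h x hx, sub_self]; exact dvd_zero _
  · exact dvd_sub ((X_pow_dvd_subseqWeight x k hx).mul_left _)
      ((X_pow_dvd_subseqWeight x k hx).mul_left _)

/-- The cofactor is minus a geometric sum, with value `-2^i` at 0. -/
lemma not_X_dvd_one_sub_div (i : ℕ) :
    ∃ g : ℤ[X], 1 - (1 + X) ^ 2 ^ i = X * g ∧ ¬ X ∣ g := by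
  refine ⟨-∑ j ∈ Finset.range (2 ^ i), (1 + X) ^ j, ?_, ?_⟩
  · have := mul_geom_sum (1 + X : ℤ[X]) (2 ^ i)
    rw [add_sub_cancel_left] at this
    rw [mul_neg, this]; ring
  · rw [X_dvd_iff, coeff_zero_eq_eval_zero]
    simp [eval_finsetSum]

lemma tmProd_eq (k : ℕ) : ∃ g : ℤ[X], tmProd (1 + X : ℤ[X]) k = X ^ k * g ∧ ¬ X ∣ g := by
  induction k with
  | zero => exact ⟨1, by simp [tmProd], by simp [X_dvd_iff]⟩
  | succ k ih =>
    obtain ⟨g, hg, hg'⟩ := ih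
    obtain ⟨f, hf, hndvd⟩ := not_X_dvd_one_sub_div k
    exact ⟨g * f, by rw [tmProd_succ, hg, hf]; ring, fun h => (prime_X.dvd_or_dvd h).elim hg' hndvd⟩

/-- The factor `tmProd (1 + X) k` contributes exactly `X^k`. -/
lemma eval_zero_of_X_pow_dvd {k : ℕ} {e : ℕ} {N : ℤ[X]}
    (h : X ^ (k + 1) ∣ (1 + X) ^ e * (tmProd (1 + X : ℤ[X]) k * N)) : N.eval 0 = 0 := by
  obtain ⟨g, hg, hg'⟩ := tmProd_eq k
  rw [hg, show (1 + X) ^ e * (X ^ k * g * N) = X ^ k * ((1 + X) ^ e * (g * N)) by ring, pow_succ]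
    at h
  have h' := (mul_dvd_mul_iff_left (pow_ne_zero k X_ne_zero)).1 h
  rcases prime_X.dvd_or_dvd h' with h₁ | h₁
  · have := prime_X.dvd_of_dvd_pow h₁
    simp [X_dvd_iff] at this
  rcases prime_X.dvd_or_dvd h₁ with h₂ | h₂
  · exact absurd h₂ hg'
  · rwa [X_dvd_iff, coeff_zero_eq_eval_zero] at h₂

lemma eval_zero_pol (e : ℕ) (w : Word) : (pol ((1 + X : ℤ[X]) ^ e) w).eval 0 = balance w := by
  have := map_pol (evalRingHom (0 : ℤ)) ((1 + X : ℤ[X]) ^ e) w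
  simpa using this

/-! ### The Magnus transform and equivalence of blocks. -/

/-- The Magnus transform `∏ (1 + w_i)` of a word, in the algebra of noncommutative polynomials. -/
noncomputable def magnus (w : Word) : MonoidAlgebra ℤ (FreeMonoid Bool) :=
  (w.map fun a => 1 + MonoidAlgebra.single (FreeMonoid.of a) 1).prod

lemma magnus_append (u v : Word) : magnus (u ++ v) = magnus u * magnus v := by simp [magnus]

lemma magnus_singleton (a : Bool) :
    magnus [a] = 1 + MonoidAlgebra.single (FreeMonoid.of a) 1 := by simp [magnus]

lemma magnus_eq_sum (w : Word) :
    magnus w = (w.sublists.map fun y => MonoidAlgebra.single (FreeMonoid.ofList y) (1 : ℤ)).sum := by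
  induction w using List.reverseRecOn with
  | nil => simp [magnus, MonoidAlgebra.one_def]
  | append_singleton w a ih =>
    rw [magnus_append, ih, magnus_singleton, List.sublists_concat, List.map_append, List.sum_append,
      mul_add, mul_one, List.map_map, ← List.sum_map_mul_right]
    congr 3
    funext y
    simp [MonoidAlgebra.single_mul_single, FreeMonoid.ofList_append]

lemma coeff_magnus (w x : Word) : (magnus w).coeff (FreeMonoid.ofList x) = binom w x := by
  classical
  rw [magnus_eq_sum, binom]
  induction w.sublists with
  | nil => simp
  | cons y l ih =>
    rw [List.map_cons, List.sum_cons, MonoidAlgebra.coeff_add, Finsupp.add_apply, ih,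
      MonoidAlgebra.coeff_single, Finsupp.single_apply, List.count_cons]
    by_cases h : y = x
    · simp [h, add_comm]
    · have hne : ¬ FreeMonoid.ofList y = FreeMonoid.ofList x := h
      simp [h, hne]

/-- All terms of `f` have degree at least `k`. -/
def OrderGE (k : ℕ) (f : MonoidAlgebra ℤ (FreeMonoid Bool)) : Prop :=
  ∀ x : FreeMonoid Bool, x.length < k → f.coeff x = 0

lemma OrderGE.sub {k : ℕ} {f g : MonoidAlgebra ℤ (FreeMonoid Bool)} (hf : OrderGE k f)
    (hg : OrderGE k g) : OrderGE k (f - g) := fun x hx => by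
  rw [MonoidAlgebra.coeff_sub, Finsupp.sub_apply, hf x hx, hg x hx, sub_zero]

lemma OrderGE.add {k : ℕ} {f g : MonoidAlgebra ℤ (FreeMonoid Bool)} (hf : OrderGE k f)
    (hg : OrderGE k g) : OrderGE k (f + g) := fun x hx => by
  rw [MonoidAlgebra.coeff_add, Finsupp.add_apply, hf x hx, hg x hx, add_zero]

lemma OrderGE.mul {i j : ℕ} {f g : MonoidAlgebra ℤ (FreeMonoid Bool)} (hf : OrderGE i f)
    (hg : OrderGE j g) : OrderGE (i + j) (f * g) := fun x hx => by
  classical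
  rw [MonoidAlgebra.coeff_mul]
  refine Finset.sum_eq_zero fun a _ => Finset.sum_eq_zero fun b _ => ?_
  dsimp only
  split_ifs with h
  · rw [← h, FreeMonoid.length_mul] at hx
    rcases lt_or_ge a.length i with ha | ha
    · rw [hf a ha, zero_mul]
    · rw [hg b (by omega), mul_zero]
  · rfl

lemma orderGE_zero (f : MonoidAlgebra ℤ (FreeMonoid Bool)) : OrderGE 0 f :=
  fun _ hx => absurd hx (Nat.not_lt_zero _)

lemma orderGE_single (a : Bool) :
    OrderGE 1 (MonoidAlgebra.single (FreeMonoid.of a) (1 : ℤ)) := fun x hx => by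
  classical
  have hx' : x = 1 := FreeMonoid.length_eq_zero.1 (by omega)
  subst hx'
  rw [MonoidAlgebra.coeff_single, Finsupp.single_apply, if_neg (FreeMonoid.of_ne_one a)]

/-- The coefficients of `magnus` are the binomial coefficients; in this form the equivalence can be
multiplied. -/
lemma binomEquiv_iff (k : ℕ) (u v : Word) :
    BinomEquiv k u v ↔ OrderGE (k + 1) (magnus u - magnus v) := by
  have key : ∀ x : Word, (magnus u - magnus v).coeff (FreeMonoid.ofList x)
      = (binom u x : ℤ) - binom v x := fun x => by
    rw [MonoidAlgebra.coeff_sub, Finsupp.sub_apply, coeff_magnus, coeff_magnus]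
  constructor
  · intro h x hx
    have := key (FreeMonoid.toList x)
    rw [FreeMonoid.ofList_toList, h _ (Nat.lt_succ_iff.1 hx), sub_self] at this
    exact this
  · intro h x hx
    have := h (FreeMonoid.ofList x) (Nat.lt_succ_iff.2 hx)
    rw [key] at this
    omega

lemma BinomEquiv.refl (k : ℕ) (u : Word) : BinomEquiv k u u := fun _ _ => rfl

lemma BinomEquiv.symm {k : ℕ} {u v : Word} (h : BinomEquiv k u v) : BinomEquiv k v u :=
  fun x hx => (h x hx).symm

lemma BinomEquiv.trans {k : ℕ} {u v w : Word} (h : BinomEquiv k u v) (h' : BinomEquiv k v w) :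
    BinomEquiv k u w := fun x hx => (h x hx).trans (h' x hx)

/-- `k`-binomial equivalence is a congruence. -/
lemma BinomEquiv.append {k : ℕ} {u v u' v' : Word} (h : BinomEquiv k u v)
    (h' : BinomEquiv k u' v') : BinomEquiv k (u ++ u') (v ++ v') := by
  rw [binomEquiv_iff] at *
  have e : magnus (u ++ u') - magnus (v ++ v')
      = (magnus u - magnus v) * magnus u' + magnus v * (magnus u' - magnus v') := by
    rw [magnus_append, magnus_append]; noncomm_ring
  rw [e]
  have h₁ := h.mul (orderGE_zero (magnus u'))
  have h₂ := (orderGE_zero (magnus v)).mul h'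
  rw [add_zero] at h₁
  rw [zero_add] at h₂
  exact h₁.add h₂

lemma orderGE_magnus_sub_one (w : Word) : OrderGE 1 (magnus w - 1) := by
  induction w with
  | nil => intro x _; simp [magnus]
  | cons a w ih =>
    have e : magnus (a :: w) - 1 = (magnus w - 1)
        + MonoidAlgebra.single (FreeMonoid.of a) 1 * magnus w := by
      rw [← List.singleton_append, magnus_append, magnus_singleton]; noncomm_ring
    rw [e]
    have h := (orderGE_single a).mul (orderGE_zero (magnus w))
    exact ih.add h

/-- With `A`, `B` the transforms of the two blocks of order `k`, the next difference is `AB - BA`,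
the commutator of `A - B` with `A - 1`. The second factor has order at least 1, so each step gains
one degree. -/
lemma orderGE_magnus_φ_iterate_sub (k : ℕ) (a : Bool) :
    OrderGE (k + 1) (magnus (φ^[k] [a]) - magnus (φ^[k] [!a])) := by
  induction k generalizing a with
  | zero =>
    simp only [Function.iterate_zero, id, magnus_singleton, add_sub_add_left_eq_sub]
    exact (orderGE_single a).sub (orderGE_single (!a))
  | succ k ih =>
    have e : magnus (φ^[k + 1] [a]) - magnus (φ^[k + 1] [!a])
        = (magnus (φ^[k] [a]) - magnus (φ^[k] [!a])) * (magnus (φ^[k] [a]) - 1)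
          - (magnus (φ^[k] [a]) - 1) * (magnus (φ^[k] [a]) - magnus (φ^[k] [!a])) := by
      rw [φ_iterate_succ_singleton, φ_iterate_succ_singleton, Bool.not_not, magnus_append,
        magnus_append]
      noncomm_ring
    rw [e]
    have h₁ := (ih a).mul (orderGE_magnus_sub_one (φ^[k] [a]))
    have h₂ := (orderGE_magnus_sub_one (φ^[k] [a])).mul (ih a)
    rw [add_comm 1] at h₂
    exact h₁.sub h₂

lemma binomEquiv_φ_iterate_singleton (k : ℕ) (a b : Bool) :
    BinomEquiv k (φ^[k] [a]) (φ^[k] [b]) := by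
  by_cases h : a = b
  · rw [h]; exact BinomEquiv.refl _ _
  · have : b = !a := by cases a <;> cases b <;> simp_all
    rw [this, binomEquiv_iff]
    exact orderGE_magnus_φ_iterate_sub k a

/-- Up to `k`-binomial equivalence, `φ^k(w)` depends only on the length of `w`. -/
lemma binomEquiv_φ_iterate (k : ℕ) {w w' : Word} (h : w.length = w'.length) :
    BinomEquiv k (φ^[k] w) (φ^[k] w') := by
  induction w generalizing w' with
  | nil => rw [List.length_nil, eq_comm, List.length_eq_zero_iff] at h; rw [h]; exact .refl _ _
  | cons a w ih =>
    cases w' with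
    | nil => simp at h
    | cons b w' =>
      rw [← List.singleton_append, ← List.singleton_append (x := b), φ_iterate_append,
        φ_iterate_append]
      exact (binomEquiv_φ_iterate_singleton k a b).append (ih (by simpa using h))

/-! ### Sufficiency: sliding half-blocks. -/

lemma cons_φ_replicate (a : Bool) (m : ℕ) :
    a :: φ (List.replicate m (!a)) = φ (List.replicate m a) ++ [a] := by
  induction m with
  | zero => rfl
  | succ m ih => simp [List.replicate_succ, ← ih]

/-- Half-blocks commute with blocks. -/
lemma binomEquiv_half_comm (k : ℕ) (a : Bool) {w w' : Word} (h : w.length = w'.length) :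
    BinomEquiv (k + 1) (φ^[k] [a] ++ φ^[k + 1] w) (φ^[k + 1] w' ++ φ^[k] [a]) := by
  -- Blocks may be exchanged freely, so `w` is replaced by a constant word, for which the
  -- commutation is an equality of words.
  have e : φ^[k] [a] ++ φ^[k + 1] (List.replicate w.length (!a))
      = φ^[k + 1] (List.replicate w.length a) ++ φ^[k] [a] := by
    rw [Function.iterate_succ_apply, Function.iterate_succ_apply, ← φ_iterate_append,
      ← φ_iterate_append, ← cons_φ_replicate]
    rfl
  refine ((BinomEquiv.refl _ _).append 
    (binomEquiv_φ_iterate (k + 1) (w' := List.replicate w.length (!a)) (by simp))).trans ?_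
  exact e ▸ (binomEquiv_φ_iterate _ (by simp [h])).append (.refl _ _)

/-- The left half-block slides across and merges with the right one into a full block. -/
lemma binomEquiv_half_around (k : ℕ) (a : Bool) {w w' : Word} (h : w'.length = w.length + 1) :
    BinomEquiv (k + 1) (φ^[k] [a] ++ φ^[k + 1] w ++ φ^[k] [!a]) (φ^[k + 1] w') := by
  refine ((binomEquiv_half_comm k a rfl).append (.refl _ _)).trans ?_
  rw [List.append_assoc, ← φ_iterate_succ_singleton, ← φ_iterate_append]
  exact binomEquiv_φ_iterate _ (by simp [h])

/-- Equivalent types give binomially equivalent words. -/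
theorem binomEquiv_of_typeEquiv {k : ℕ} {q₁ q₂ : Word × Word} {w₁ w₂ : Word}
    (hlen : (q₁.1 ++ φ^[k + 1] w₁ ++ q₁.2).length = (q₂.1 ++ φ^[k + 1] w₂ ++ q₂.2).length)
    (h : TypeEquiv (k + 1) q₁ q₂) :
    BinomEquiv (k + 1) (q₁.1 ++ φ^[k + 1] w₁ ++ q₁.2) (q₂.1 ++ φ^[k + 1] w₂ ++ q₂.2) := by
  obtain ⟨p₁, s₁⟩ := q₁
  obtain ⟨p₂, s₂⟩ := q₂
  have hpos : 0 < 2 ^ (k + 1) := by positivity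
  simp only [List.length_append, length_φ_iterate] at hlen
  have around : ∀ (a : Bool) (p s w w' : Word), w'.length = w.length + 1 →
      BinomEquiv (k + 1) ((p ++ φ^[k] [a]) ++ φ^[k + 1] w ++ (φ^[k] [!a] ++ s))
        (p ++ φ^[k + 1] w' ++ s) := fun a p s w w' hw => by
    simpa only [List.append_assoc] using
      ((BinomEquiv.refl _ p).append (binomEquiv_half_around k a hw)).append (.refl _ s)
  have comm : ∀ (a : Bool) (p s w w' : Word), w.length = w'.length →
      BinomEquiv (k + 1) ((p ++ φ^[k] [a]) ++ φ^[k + 1] w ++ s)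
        (p ++ φ^[k + 1] w' ++ (φ^[k] [a] ++ s)) := fun a p s w w' hw => by
    simpa only [List.append_assoc] using
      ((BinomEquiv.refl _ p).append (binomEquiv_half_comm k a hw)).append (.refl _ s)
  have same : p₁.length + s₁.length = p₂.length + s₂.length → w₁.length = w₂.length := fun h =>
    Nat.eq_of_mul_eq_mul_left hpos (by omega)
  obtain ⟨-, a, ⟨hl, h | h | h | h⟩ | ⟨-, h | h⟩⟩ := h <;>
    simp only [Prod.mk.injEq, Nat.add_sub_cancel] at h
  · obtain ⟨rfl, rfl⟩ := h
    exact ((BinomEquiv.refl _ _).append (binomEquiv_φ_iterate _ (same hl))).append (.refl _ _)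
  · obtain ⟨rfl, rfl⟩ := h
    exact comm a _ _ _ _ (same hl)
  · obtain ⟨rfl, rfl⟩ := h
    exact (comm a _ _ _ _ (same hl).symm).symm
  · obtain ⟨⟨rfl, rfl⟩, rfl, rfl⟩ := h
    -- Both swapped forms are compared with the same word made of full blocks.
    have h₁ := around a [] [] w₁ (List.replicate (w₁.length + 1) a) (by simp)
    have h₂ := around (!a) [] [] w₂ (List.replicate (w₁.length + 1) a) (by simp [same hl])
    simp only [List.nil_append, List.append_nil, Bool.not_not] at h₁ h₂
    exact h₁.trans h₂.symm
  · obtain ⟨rfl, rfl⟩ := h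
    refine around a _ _ _ _ (Nat.eq_of_mul_eq_mul_left hpos ?_)
    simp only [List.length_append, length_φ_iterate, List.length_singleton] at hlen
    rw [pow_succ] at hlen ⊢
    linarith
  · obtain ⟨rfl, rfl⟩ := h
    refine (around a _ _ _ _ (Nat.eq_of_mul_eq_mul_left hpos ?_)).symm
    simp only [List.length_append, length_φ_iterate, List.length_singleton] at hlen
    rw [pow_succ] at hlen ⊢
    linarith

/-! ### Passing between cuts of orders `k` and `k + 1`. -/

/-- The word `q φ^k(t_{[c, c+l)}) r` is a factor of `t` cut at its first and last bars of
order `k`. -/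
structure Occ (k c l : ℕ) (q r : Word) : Prop where
  left : q = [] ∨ ∃ c', c = c' + 1 ∧ q <:+ φ^[k] [t c']
  right : r <+: φ^[k] [t (c + l)]
  left_lt : q.length < 2 ^ k
  right_lt : r.length < 2 ^ k

/-- A factor cut at its bars of order `k` as `(q, r)` and at its bars of order `k + 1` as `(p, s)`;
`δ` and `δ'` tell whether the outer bars of order `k` are not of order `k + 1`. -/
structure HalfOcc (k : ℕ) (q r : Word) (d l δ δ' c m : ℕ) (p s : Word) : Prop where
  occ : Occ k d l q r
  left_le : δ ≤ 1
  right_le : δ' ≤ 1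
  start_eq : d + δ = 2 * c
  length_eq : l = 2 * m + δ + δ'
  left_eq : p = q ++ φ^[k] (tFactor d δ)
  right_eq : s = φ^[k] (tFactor (2 * (c + m)) δ') ++ r
  left_lt : p.length < 2 ^ (k + 1)
  right_lt : s.length < 2 ^ (k + 1)

lemma suffix_φ_succ_singleton {k : ℕ} {p : Word} {b : Bool} (h : p <:+ φ^[k + 1] [b]) :
    (p <:+ φ^[k] [!b] ∧ p.length < 2 ^ k) ∨ ∃ q, p = q ++ φ^[k] [!b] ∧ q <:+ φ^[k] [b] := by
  rw [φ_iterate_succ_singleton] at h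
  have aux : φ^[k] [!b] <:+ p → ∃ q, p = q ++ φ^[k] [!b] ∧ q <:+ φ^[k] [b] := by
    rintro ⟨q, rfl⟩
    obtain ⟨y, hy⟩ := h
    rw [← List.append_assoc] at hy
    exact ⟨q, rfl, y, List.append_cancel_right hy⟩
  rcases List.suffix_or_suffix_of_suffix h (List.suffix_append _ _) with h' | h'
  -- A suffix equal to the half-block goes to the second alternative with empty `q`, which keeps the
  -- first bound strict.
  · rcases h'.length_le.lt_or_eq with hl | hl
    · exact Or.inl ⟨h', by simpa using hl⟩
    · exact Or.inr (aux (h'.eq_of_length hl ▸ List.suffix_rfl))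
  · exact Or.inr (aux h')

lemma prefix_φ_succ_singleton {k : ℕ} {s : Word} {b : Bool} (h : s <+: φ^[k + 1] [b]) :
    (s <+: φ^[k] [b] ∧ s.length < 2 ^ k) ∨ ∃ r, s = φ^[k] [b] ++ r ∧ r <+: φ^[k] [!b] := by
  rw [φ_iterate_succ_singleton] at h
  have aux : φ^[k] [b] <+: s → ∃ r, s = φ^[k] [b] ++ r ∧ r <+: φ^[k] [!b] := by
    rintro ⟨r, rfl⟩
    exact ⟨r, rfl, (List.prefix_append_right_inj _).1 h⟩
  rcases List.prefix_or_prefix_of_prefix h (List.prefix_append _ _) with h' | h'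
  · rcases h'.length_le.lt_or_eq with hl | hl
    · exact Or.inl ⟨h', by simpa using hl⟩
    · exact Or.inr (aux (h'.eq_of_length hl ▸ List.prefix_rfl))
  · exact Or.inr (aux h')

lemma append_suffix_φ_succ {k : ℕ} {q : Word} {a b : Bool}
    (h : q ++ φ^[k] [a] <:+ φ^[k + 1] [b]) : b = (!a) ∧ q <:+ φ^[k] [!a] := by
  rcases suffix_φ_succ_singleton h with ⟨-, h'⟩ | ⟨q', h', hq⟩
  · simp at h'
  · obtain ⟨rfl, h₂⟩ := List.append_inj' h' (by simp)
    have := φ_iterate_singleton_injective h₂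
    subst this
    simpa using hq

lemma append_prefix_φ_succ {k : ℕ} {r : Word} {a b : Bool}
    (h : φ^[k] [a] ++ r <+: φ^[k + 1] [b]) : b = a ∧ r <+: φ^[k] [!a] := by
  rcases prefix_φ_succ_singleton h with ⟨-, h'⟩ | ⟨r', h', hr⟩
  · simp at h'
  · obtain ⟨h₂, rfl⟩ := List.append_inj h' (by simp)
    have := φ_iterate_singleton_injective h₂
    subst this
    exact ⟨rfl, hr⟩

/-- Each outer part is shorter than a block of order `k + 1`, so it contains at most one whole
half-block adjacent to the cut; `δ` and `δ'` record its presence. -/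
lemma Occ.exists_half {k c m : ℕ} {p s : Word} (h : Occ (k + 1) c m p s) :
    ∃ q r d l δ δ', HalfOcc k q r d l δ δ' c m p s := by
  have hpos : 0 < 2 ^ k := by positivity
  have hL : ∃ q d δ, δ ≤ 1 ∧ d + δ = 2 * c ∧ p = q ++ φ^[k] (tFactor d δ) ∧ q.length < 2 ^ k ∧
      (q = [] ∨ ∃ c', d = c' + 1 ∧ q <:+ φ^[k] [t c']) := by
    rcases h.left with rfl | ⟨c', rfl, hp⟩
    · exact ⟨[], 2 * c, 0, by simp, by simp, by simp, by simp, Or.inl rfl⟩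
    rcases suffix_φ_succ_singleton hp with ⟨h', hl⟩ | ⟨q, rfl, hq⟩
    · exact ⟨p, 2 * (c' + 1), 0, by simp, by simp, by simp, hl,
        Or.inr ⟨2 * c' + 1, by ring, by rwa [t_two_mul_add_one]⟩⟩
    · refine ⟨q, 2 * c' + 1, 1, le_rfl, by ring, by rw [tFactor_one, t_two_mul_add_one], ?_,
        Or.inr ⟨2 * c', rfl, by rwa [t_two_mul]⟩⟩
      have := h.left_lt
      simp [pow_succ] at this
      omega
  have hR : ∃ r δ', δ' ≤ 1 ∧ s = φ^[k] (tFactor (2 * (c + m)) δ') ++ r ∧ r.length < 2 ^ k ∧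
      r <+: φ^[k] [t (2 * (c + m) + δ')] := by
    rcases prefix_φ_succ_singleton h.right with ⟨h', hl⟩ | ⟨r, rfl, hr⟩
    · exact ⟨s, 0, by simp, by simp, hl, by rwa [add_zero, t_two_mul]⟩
    · refine ⟨r, 1, le_rfl, by rw [tFactor_one, t_two_mul], ?_, by rwa [t_two_mul_add_one]⟩
      have := h.right_lt
      simp [pow_succ] at this
      omega
  obtain ⟨q, d, δ, hδ, hd, hp, hq, hq'⟩ := hL
  obtain ⟨r, δ', hδ', hs, hr, hr'⟩ := hR
  refine ⟨q, r, d, 2 * m + δ + δ', δ, δ', ⟨⟨hq', ?_, hq, hr⟩, hδ, hδ', hd, rfl, hp, hs,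
    h.left_lt, h.right_lt⟩⟩
  rwa [show d + (2 * m + δ + δ') = 2 * (c + m) + δ' by omega]

section
variable {k d l δ δ' c m : ℕ} {q r p s : Word}

lemma HalfOcc.tFactor_eq (h : HalfOcc k q r d l δ δ' c m p s) :
    tFactor d l = tFactor d δ ++ tFactor (2 * c) (2 * m) ++ tFactor (2 * (c + m)) δ' := by
  rw [h.length_eq, show 2 * m + δ + δ' = δ + (2 * m + δ') by ring, tFactor_add, tFactor_add,
    h.start_eq, ← mul_add, List.append_assoc]

lemma HalfOcc.word_eq (h : HalfOcc k q r d l δ δ' c m p s) :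
    q ++ φ^[k] (tFactor d l) ++ r = p ++ φ^[k + 1] (tFactor c m) ++ s := by
  rw [h.tFactor_eq, h.left_eq, h.right_eq, Function.iterate_succ_apply, φ_tFactor]
  simp only [φ_iterate_append, List.append_assoc]

/-- The aligned middle is an image of `φ`, hence balanced; only the outer half-blocks count. -/
lemma HalfOcc.balance_eq (h : HalfOcc k q r d l δ δ' c m p s) :
    balance (tFactor d l) = balance (tFactor d δ) + balance (tFactor (2 * (c + m)) δ') := by
  rw [h.tFactor_eq, balance_append, balance_append, balance_tFactor_even, add_zero]

end

lemma ε_injective : Function.Injective ε := by decide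

lemma eq_not_of_ne {a b : Bool} (h : a ≠ b) : b = !a := by revert a b; decide

lemma eq_not_of_ε_add {a b : Bool} (h : ε a + ε b = 0) : b = !a := by
  revert a b; decide

/-- Factors with the same cut of order `k` and the same numbers of blocks of each kind have
equivalent types of order `k + 1`. -/
theorem HalfOcc.typeEquiv {k l : ℕ} {q r : Word}
    {d₁ δ₁ δ₁' c₁ m₁ : ℕ} {p₁ s₁ : Word} {d₂ δ₂ δ₂' c₂ m₂ : ℕ} {p₂ s₂ : Word}
    (h₁ : HalfOcc k q r d₁ l δ₁ δ₁' c₁ m₁ p₁ s₁) (h₂ : HalfOcc k q r d₂ l δ₂ δ₂' c₂ m₂ p₂ s₂)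
    (hb : balance (tFactor d₁ l) = balance (tFactor d₂ l)) :
    TypeEquiv (k + 1) (p₁, s₁) (p₂, s₂) := by
  refine ⟨⟨h₁.left_lt, h₁.right_lt, h₂.left_lt, h₂.right_lt⟩, ?_⟩
  rw [h₁.balance_eq, h₂.balance_eq] at hb
  obtain ⟨o₁, a₁, b₁, e₁, f₁, rfl, rfl, -, -⟩ := h₁
  obtain ⟨o₂, a₂, b₂, e₂, f₂, rfl, rfl, -, -⟩ := h₂
  simp only [Nat.add_sub_cancel]
  have habs : ∀ a b : Bool, |(((q ++ φ^[k] [a]).length + (φ^[k] [b] ++ r).length : ℕ) : ℤ)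
      - ((q.length + r.length : ℕ) : ℤ)| = 2 ^ (k + 1) := by
    intro a b
    rw [show (((q ++ φ^[k] [a]).length + (φ^[k] [b] ++ r).length : ℕ) : ℤ)
      - ((q.length + r.length : ℕ) : ℤ) = 2 ^ (k + 1) by simp; ring]
    exact abs_of_pos (by positivity)
  -- Both cuts have the same `l`, so `δ₁ + δ₁'` and `δ₂ + δ₂'` have the same parity: eight of the
  -- sixteen cases survive.
  interval_cases δ₁ <;> interval_cases δ₁' <;> interval_cases δ₂ <;> interval_cases δ₂' <;>
    try omega
  all_goals
    simp only [tFactor_zero, tFactor_one, φ_iterate_nil, List.nil_append, List.append_nil,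
      balance_singleton, pol_nil, balance, zero_add, add_zero] at hb ⊢
  · exact ⟨false, Or.inl ⟨trivial, Or.inl trivial⟩⟩
  · exact ⟨t d₂, Or.inr ⟨by rw [abs_sub_comm]; exact habs _ _,
      Or.inr (by rw [eq_not_of_ε_add hb.symm])⟩⟩
  · rw [ε_injective hb]
    exact ⟨false, Or.inl ⟨rfl, Or.inl rfl⟩⟩
  · rw [ε_injective hb]
    exact ⟨t d₂, Or.inl ⟨by simp; ring, Or.inr (Or.inr (Or.inl rfl))⟩⟩
  · rw [ε_injective hb]
    exact ⟨t (2 * (c₂ + m₂)), Or.inl ⟨by simp; ring, Or.inr (Or.inl rfl)⟩⟩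
  · rw [ε_injective hb]
    exact ⟨false, Or.inl ⟨rfl, Or.inl rfl⟩⟩
  · exact ⟨t d₁, Or.inr ⟨habs _ _, Or.inl (by rw [eq_not_of_ε_add hb])⟩⟩
  -- With half-blocks at all ends and distinct left letters, equal balances force a swap. The
  -- remainders `q` and `r` then lie in blocks of opposite letters, so they are empty, which is case
  -- (d).
  · by_cases hd : t d₁ = t d₂
    · rw [hd, add_right_inj] at hb
      rw [hd, ε_injective hb]
      exact ⟨false, Or.inl ⟨rfl, Or.inl rfl⟩⟩
    have hd₂ := eq_not_of_ne hd
    have hy : t (2 * (c₁ + m₁)) = !t d₁ ∧ t (2 * (c₂ + m₂)) = t d₁ := by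
      rw [hd₂] at hb
      generalize t d₁ = x, t (2 * (c₁ + m₁)) = y, t (2 * (c₂ + m₂)) = z at hb
      revert x y z; decide
    have hr : r = [] := by
      have r₁ := o₁.right
      have r₂ := o₂.right
      rw [show d₁ + l = 2 * (c₁ + m₁) + 1 by omega, t_two_mul_add_one, ← t_two_mul, hy.1] at r₁
      rw [show d₂ + l = 2 * (c₂ + m₂) + 1 by omega, t_two_mul_add_one, ← t_two_mul, hy.2] at r₂
      rw [Bool.not_not] at r₁
      exact eq_nil_of_prefix_of_prefix r₁ r₂
    have hq : q = [] := by
      rcases o₁.left with h | ⟨i, hi, q₁⟩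
      · exact h
      rcases o₂.left with h | ⟨j, hj, q₂⟩
      · exact h
      have hi' : t d₁ = !t i := by
        obtain ⟨e, rfl⟩ : ∃ e, i = 2 * e := ⟨i / 2, by omega⟩
        rw [hi, t_two_mul_add_one, t_two_mul]
      have hj' : t d₂ = !t j := by
        obtain ⟨e, rfl⟩ : ∃ e, j = 2 * e := ⟨j / 2, by omega⟩
        rw [hj, t_two_mul_add_one, t_two_mul]
      refine eq_nil_of_suffix_of_suffix q₁ q₂ fun h => hd ?_
      rw [hi', hj', Bool.xor_left_inj.1 h]
    subst hr hq
    refine ⟨t d₁, Or.inl ⟨by simp, Or.inr (Or.inr (Or.inr ?_))⟩⟩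
    rw [hy.1, hy.2, hd₂]
    simp

/-! ### The first two coefficients of a difference of polynomials. -/

section
variable {k : ℕ} {q r x y : Word}

lemma pol_sub_pol (z : ℤ[X]) (hxy : x.length = y.length) :
    pol z (q ++ φ^[k] x ++ r) - pol z (q ++ φ^[k] y ++ r)
      = z ^ q.length * (tmProd z k * (pol (z ^ 2 ^ k) x - pol (z ^ 2 ^ k) y)) := by
  simp only [pol_append, pol_φ_iterate, List.length_append, length_φ_iterate, hxy]
  ring

lemma balance_eq_of_dvd (hxy : x.length = y.length)
    (h : (X : ℤ[X]) ^ (k + 1) ∣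
      pol (1 + X) (q ++ φ^[k] x ++ r) - pol (1 + X) (q ++ φ^[k] y ++ r)) :
    balance x = balance y := by
  rw [pol_sub_pol _ hxy] at h
  have := eval_zero_of_X_pow_dvd h
  rwa [eval_sub, eval_zero_pol, eval_zero_pol, sub_eq_zero] at this

/-- A factor `1 - z` extracted with `z = (1 + X)^(2^k)` completes `tmProd` to order `k + 1`, which
exposes the next coefficient. -/
lemma eval_eq_zero_of_dvd {N : ℤ[X]} (hxy : x.length = y.length)
    (hN : pol ((1 + X) ^ 2 ^ k) x - pol ((1 + X) ^ 2 ^ k) y = (1 - (1 + X) ^ 2 ^ k) * N)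
    (h : (X : ℤ[X]) ^ (k + 2) ∣
      pol (1 + X) (q ++ φ^[k] x ++ r) - pol (1 + X) (q ++ φ^[k] y ++ r)) :
    N.eval 0 = 0 := by
  rw [pol_sub_pol _ hxy, hN, ← mul_assoc (tmProd _ _), ← tmProd_succ] at h
  exact eval_zero_of_X_pow_dvd h

lemma eval_zero_geom (e n : ℕ) :
    (∑ i ∈ Finset.range n, ((1 + X : ℤ[X]) ^ e) ^ i).eval 0 = n := by
  simp [eval_finsetSum]

lemma eval_zero_pol_sq (e : ℕ) (w : Word) :
    (pol (((1 + X : ℤ[X]) ^ e) ^ 2) w).eval 0 = balance w := by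
  rw [← pow_mul, eval_zero_pol]

lemma balance_of_dvd_comm {a : Bool} (hxy : x.length = y.length)
    (h : (X : ℤ[X]) ^ (k + 2) ∣ pol (1 + X) (q ++ φ^[k] (a :: φ x) ++ r) -
      pol (1 + X) (q ++ φ^[k] (φ y ++ [a]) ++ r)) :
    ε a * (2 * x.length) + balance x - balance y = 0 := by
  set z : ℤ[X] := (1 + X) ^ 2 ^ k with hz
  -- The two positions of `a` differ by `2|x|`, so they contribute `ε(a) (1 - z^(2|x|))`; dividing
  -- by `1 - z` leaves the geometric sum.
  have := eval_eq_zero_of_dvd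
    (N := (ε a : ℤ[X]) * ∑ i ∈ Finset.range (2 * x.length), z ^ i + z * pol (z ^ 2) x
      - pol (z ^ 2) y) (by simp [length_φ, hxy]) ?_ h
  · rw [eval_sub, eval_add, eval_mul, eval_mul, hz, eval_zero_geom, eval_zero_pol_sq,
      eval_zero_pol_sq] at this
    simpa using this
  · rw [← hz, pol_append, pol_cons, pol_φ, pol_φ, pol_cons, pol_nil, length_φ, ← hxy]
    linear_combination -(ε a : ℤ[X]) * mul_neg_geom_sum z (2 * x.length)

lemma balance_of_dvd_swap {a : Bool} (hxy : x.length = y.length)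
    (h : (X : ℤ[X]) ^ (k + 2) ∣ pol (1 + X) (q ++ φ^[k] (a :: (φ x ++ [!a])) ++ r) -
      pol (1 + X) (q ++ φ^[k] ((!a) :: (φ y ++ [a])) ++ r)) :
    2 * ε a * (2 * x.length + 1) + balance x - balance y = 0 := by
  set z : ℤ[X] := (1 + X) ^ 2 ^ k with hz
  have := eval_eq_zero_of_dvd
    (N := 2 * (ε a : ℤ[X]) * ∑ i ∈ Finset.range (2 * x.length + 1), z ^ i + z * pol (z ^ 2) x
      - z * pol (z ^ 2) y) (by simp [length_φ, hxy]) ?_ h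
  · rw [eval_sub, eval_add, eval_mul, eval_mul, eval_mul, eval_mul, hz, eval_zero_geom, eval_zero_pol_sq,
      eval_zero_pol_sq] at this
    simpa using this
  · rw [← hz, pol_cons, pol_cons, pol_append, pol_append, pol_φ, pol_φ, pol_cons, pol_nil,
      pol_cons, pol_nil, length_φ, length_φ, ← hxy, ε_not]
    push_cast
    linear_combination -2 * (ε a : ℤ[X]) * mul_neg_geom_sum z (2 * x.length + 1)

lemma balance_of_dvd_around {a : Bool} (hxy : x.length + 1 = y.length)
    (h : (X : ℤ[X]) ^ (k + 2) ∣ pol (1 + X) (q ++ φ^[k] (a :: (φ x ++ [!a])) ++ r) -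
      pol (1 + X) (q ++ φ^[k] (φ y) ++ r)) :
    ε a * (2 * x.length + 1) + balance x - balance y = 0 := by
  set z : ℤ[X] := (1 + X) ^ 2 ^ k with hz
  have := eval_eq_zero_of_dvd
    (N := (ε a : ℤ[X]) * ∑ i ∈ Finset.range (2 * x.length + 1), z ^ i + z * pol (z ^ 2) x
      - pol (z ^ 2) y) (by simp [length_φ, ← hxy]; ring) ?_ h
  · rw [eval_sub, eval_add, eval_mul, eval_mul, hz, eval_zero_geom, eval_zero_pol_sq,
      eval_zero_pol_sq] at this
    simpa using this
  · rw [← hz, pol_cons, pol_append, pol_φ, pol_φ, pol_cons, pol_nil, length_φ, ε_not]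
    push_cast
    linear_combination -(ε a : ℤ[X]) * mul_neg_geom_sum z (2 * x.length + 1)

end

/-! ### Excluding the nontrivial cases of the lower-order relation. -/

section
variable {k : ℕ} {d₁ l₁ d₂ l₂ : ℕ} {r₁ q₂ r₂ : Word} {a : Bool}

lemma Occ.left_append {d l : ℕ} {q r : Word} (h : Occ (k + 1) d l (q ++ φ^[k] [a]) r) :
    ∃ e, d = e + 1 ∧ t e = (!a) ∧ q <:+ φ^[k] [!a] := by
  rcases h.left with h' | ⟨e, rfl, h'⟩
  · have := congrArg List.length h'
    simp at this
  · exact ⟨e, rfl, append_suffix_φ_succ h'⟩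

lemma ε_eq (a : Bool) : ε a = 1 ∨ ε a = -1 := by revert a; decide

lemma eq_not_of_ε_eq_neg {a b : Bool} (h : ε b = -ε a) : b = !a :=
  eq_not_of_ε_add (by rw [h, add_neg_cancel])

lemma letters_of_one_block {a x y : Bool} (h : ε a * 2 + ε x - ε y = 0) : x = (!a) ∧ y = a := by
  revert a x y; decide

lemma letters_of_two_blocks {a x y x' y' : Bool}
    (h : ε a * 4 + (ε x + ε y) - (ε x' + ε y') = 0) : x = (!a) ∧ y = !a := by
  revert a x y x' y'; decide

/-- Cuts of order `k + 1` related by moving a half-block from one side to the other belong to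
factors that are not binomially equivalent at order `k + 2`. -/
lemma Occ.false_of_comm (h₁ : Occ (k + 1) d₁ l₁ (q₂ ++ φ^[k] [a]) r₁)
    (h₂ : Occ (k + 1) d₂ l₂ q₂ (φ^[k] [a] ++ r₁))
    (hlen : (q₂ ++ φ^[k] [a] ++ φ^[k + 1] (tFactor d₁ l₁) ++ r₁).length
      = (q₂ ++ φ^[k + 1] (tFactor d₂ l₂) ++ (φ^[k] [a] ++ r₁)).length)
    (hn : 2 ^ (k + 2) ≤ (q₂ ++ φ^[k] [a] ++ φ^[k + 1] (tFactor d₁ l₁) ++ r₁).length + 1)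
    (hn4 : 4 ≤ (q₂ ++ φ^[k] [a] ++ φ^[k + 1] (tFactor d₁ l₁) ++ r₁).length)
    (hdvd : (X : ℤ[X]) ^ (k + 2) ∣ pol (1 + X) (q₂ ++ φ^[k] [a] ++ φ^[k + 1] (tFactor d₁ l₁) ++ r₁)
      - pol (1 + X) (q₂ ++ φ^[k + 1] (tFactor d₂ l₂) ++ (φ^[k] [a] ++ r₁))) : False := by
  have hpos : 0 < 2 ^ k := by positivity
  have hq := h₁.left_lt
  have hr := h₁.right_lt
  have hr' := h₂.right_lt
  simp only [List.length_append, length_φ_iterate, length_tFactor, List.length_singleton] at *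
  obtain rfl : l₁ = l₂ := Nat.eq_of_mul_eq_mul_left (show 0 < 2 ^ (k + 1) by positivity) (by omega)
  have hb : ε a * (2 * (tFactor d₁ l₁).length) + balance (tFactor d₁ l₁) -
      balance (tFactor d₂ l₁) = 0 := by
    refine balance_of_dvd_comm (k := k) (q := q₂) (r := r₁) (by simp) ?_
    rw [← List.singleton_append, φ_iterate_append, φ_iterate_append,
      ← Function.iterate_succ_apply φ k, ← Function.iterate_succ_apply φ k]
    simpa only [List.append_assoc] using hdvd
  rw [length_tFactor] at hb
  obtain ⟨e, rfl, hte, hq₂⟩ := h₁.left_append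
  obtain ⟨ht₂, hr₁⟩ := append_prefix_φ_succ h₂.right
  have hb₁ := abs_le.1 (abs_balance_tFactor_le (e + 1) l₁)
  have hb₂ := abs_le.1 (abs_balance_tFactor_le d₂ l₁)
  -- Two balances of absolute value at most 2 must compensate `2 l₁`.
  have hl : l₁ = 0 ∨ l₁ = 1 ∨ l₁ = 2 := by
    have : (l₁ : ℤ) ≤ 2 := by rcases ε_eq a with h | h <;> rw [h] at hb <;> linarith
    omega
  rcases hl with rfl | rfl | rfl
  · rw [pow_succ, pow_succ] at hn
    rw [pow_succ] at hq hr
    omega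
  · simp only [tFactor_one, balance_singleton] at hb
    have hx : t (e + 1) = (!a) ∧ t d₂ = a := letters_of_one_block (by simpa using hb)
    have ht₁ : t (e + 1 + 1) = a := by
      by_contra h
      exact t_no_cube _ e hte hx.1 (eq_not_of_ne (Ne.symm h))
    -- Avoiding cubes puts `r₁` in blocks of opposite letters. Below, `q₂` ends blocks of the same
    -- letter but of consecutive orders, whose last letters differ.
    have hr₀ : r₁ = [] := eq_nil_of_prefix_of_prefix (ht₁ ▸ h₁.right) hr₁
    have hq₀ : q₂ = [] := by
      rcases h₂.left with h | ⟨f, rfl, hf⟩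
      · exact h
      have htf : t f = !a := by
        by_contra h
        exact t_no_cube a f (by rw [eq_not_of_ne (Ne.symm h), Bool.not_not]) hx.2 ht₂
      rw [htf] at hf
      refine eq_nil_of_suffix_of_suffix hq₂ hf ?_
      rcases Nat.mod_two_eq_zero_or_one k with hk | hk <;>
        cases a <;> simp [Nat.succ_mod_two_eq_one_iff, hk]
    subst hr₀ hq₀
    -- The length is now `3 * 2^k`; `hn` leaves only `k = 0`, and `hn4` excludes length 3.
    simp only [pow_succ, List.length_nil] at hn hn4
    omega
  · simp only [tFactor_two, balance, pol_cons, pol_nil] at hb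
    have hx : t (e + 1) = (!a) ∧ t (e + 2) = (!a) :=
      letters_of_two_blocks (x' := t d₂) (y' := t (d₂ + 1)) (by simpa using hb)
    exact t_no_cube _ e hte hx.1 hx.2

/-- Moving both half-blocks doubles the defect: `2(2 l₁ + 1) ≤ 4` gives `l₁ = 0`, and two
half-blocks alone are too short. -/
lemma Occ.false_of_swap (h₁ : Occ (k + 1) d₁ l₁ (φ^[k] [a]) (φ^[k] [!a]))
    (hlen : (φ^[k] [a] ++ φ^[k + 1] (tFactor d₁ l₁) ++ φ^[k] [!a]).length
      = (φ^[k] [!a] ++ φ^[k + 1] (tFactor d₂ l₂) ++ φ^[k] [a]).length)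
    (hn : 2 ^ (k + 2) ≤ (φ^[k] [a] ++ φ^[k + 1] (tFactor d₁ l₁) ++ φ^[k] [!a]).length + 1)
    (hdvd : (X : ℤ[X]) ^ (k + 2) ∣ pol (1 + X) (φ^[k] [a] ++ φ^[k + 1] (tFactor d₁ l₁) ++ φ^[k] [!a])
      - pol (1 + X) (φ^[k] [!a] ++ φ^[k + 1] (tFactor d₂ l₂) ++ φ^[k] [a])) : False := by
  have hpos : 0 < 2 ^ k := by positivity
  have hq := h₁.left_lt
  simp only [List.length_append, length_φ_iterate, length_tFactor, List.length_singleton] at *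
  obtain rfl : l₁ = l₂ := Nat.eq_of_mul_eq_mul_left (show 0 < 2 ^ (k + 1) by positivity) (by omega)
  have hb : 2 * ε a * (2 * (tFactor d₁ l₁).length + 1) + balance (tFactor d₁ l₁) -
      balance (tFactor d₂ l₁) = 0 := by
    refine balance_of_dvd_swap (k := k) (q := []) (r := []) (by simp) ?_
    change _ ∣ pol _ ([] ++ φ^[k] ([a] ++ (φ _ ++ [!a])) ++ [])
      - pol _ ([] ++ φ^[k] ([!a] ++ (φ _ ++ [a])) ++ [])
    rw [φ_iterate_append, φ_iterate_append, φ_iterate_append, φ_iterate_append,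
      ← Function.iterate_succ_apply φ k, ← Function.iterate_succ_apply φ k]
    simpa only [List.append_assoc, List.nil_append, List.append_nil] using hdvd
  rw [length_tFactor] at hb
  have hb₁ := abs_le.1 (abs_balance_tFactor_le d₁ l₁)
  have hb₂ := abs_le.1 (abs_balance_tFactor_le d₂ l₁)
  have hl : l₁ = 0 := by
    have : (l₁ : ℤ) < 1 := by rcases ε_eq a with h | h <;> rw [h] at hb <;> linarith
    omega
  subst hl
  simp only [pow_succ] at hn
  omega

/-- Here `2 l₁ + 1 ≤ 4`. If `l₁ = 0` the word is too short; if `l₁ = 1` the middle letter completes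
a cube with those of the two outer blocks. -/
lemma Occ.false_of_around (h₁ : Occ (k + 1) d₁ l₁ (q₂ ++ φ^[k] [a]) (φ^[k] [!a] ++ r₂))
    (hlen : (q₂ ++ φ^[k] [a] ++ φ^[k + 1] (tFactor d₁ l₁) ++ (φ^[k] [!a] ++ r₂)).length
      = (q₂ ++ φ^[k + 1] (tFactor d₂ l₂) ++ r₂).length)
    (hn : 2 ^ (k + 2) ≤
      (q₂ ++ φ^[k] [a] ++ φ^[k + 1] (tFactor d₁ l₁) ++ (φ^[k] [!a] ++ r₂)).length + 1)
    (hdvd : (X : ℤ[X]) ^ (k + 2) ∣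
      pol (1 + X) (q₂ ++ φ^[k] [a] ++ φ^[k + 1] (tFactor d₁ l₁) ++ (φ^[k] [!a] ++ r₂))
      - pol (1 + X) (q₂ ++ φ^[k + 1] (tFactor d₂ l₂) ++ r₂)) : False := by
  have hpos : 0 < 2 ^ k := by positivity
  have hq := h₁.left_lt
  have hr := h₁.right_lt
  simp only [List.length_append, length_φ_iterate, length_tFactor, List.length_singleton] at *
  have hl₂ : l₁ + 1 = l₂ := by
    refine Nat.eq_of_mul_eq_mul_left (show 0 < 2 ^ (k + 1) by positivity) ?_
    rw [pow_succ] at hlen ⊢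
    linarith
  have hb : ε a * (2 * (tFactor d₁ l₁).length + 1) + balance (tFactor d₁ l₁) -
      balance (tFactor d₂ l₂) = 0 := by
    refine balance_of_dvd_around (k := k) (q := q₂) (r := r₂) (by simpa using hl₂) ?_
    rw [← List.singleton_append, φ_iterate_append, φ_iterate_append,
      ← Function.iterate_succ_apply φ k, ← Function.iterate_succ_apply φ k]
    simpa only [List.append_assoc] using hdvd
  rw [length_tFactor] at hb
  have hb₁ := abs_le.1 (abs_balance_tFactor_le d₁ l₁)
  have hb₂ := abs_le.1 (abs_balance_tFactor_le d₂ l₂)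
  have hl : l₁ = 0 ∨ l₁ = 1 := by
    have : (l₁ : ℤ) < 2 := by rcases ε_eq a with h | h <;> rw [h] at hb <;> linarith
    omega
  rcases hl with rfl | rfl
  · rw [pow_succ, pow_succ] at hn
    rw [pow_succ] at hq hr
    omega
  · obtain ⟨e, rfl, hte, -⟩ := h₁.left_append
    obtain ⟨hte₂, -⟩ := append_prefix_φ_succ h₁.right
    refine t_no_cube _ e hte (eq_not_of_ε_eq_neg ?_) hte₂
    rw [tFactor_one, balance_singleton] at hb
    rcases ε_eq a with h | h <;> rcases ε_eq (t (e + 1)) with h' | h' <;> rw [h, h'] at hb ⊢ <;>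
      push_cast at hb <;> linarith
end

/-! ### Necessity: induction on the order. -/

/-- Factors whose polynomials agree modulo `X^(k+1)` have equivalent types of order `k + 1`. -/
theorem Occ.typeEquiv_of_dvd {k : ℕ} {c₁ m₁ c₂ m₂ : ℕ} {p₁ s₁ p₂ s₂ : Word}
    (h₁ : Occ (k + 1) c₁ m₁ p₁ s₁) (h₂ : Occ (k + 1) c₂ m₂ p₂ s₂)
    (hlen : (p₁ ++ φ^[k + 1] (tFactor c₁ m₁) ++ s₁).length
      = (p₂ ++ φ^[k + 1] (tFactor c₂ m₂) ++ s₂).length)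
    (hn : 2 ^ (k + 1) ≤ (p₁ ++ φ^[k + 1] (tFactor c₁ m₁) ++ s₁).length + 1)
    (hn4 : 4 ≤ (p₁ ++ φ^[k + 1] (tFactor c₁ m₁) ++ s₁).length)
    (hdvd : (X : ℤ[X]) ^ (k + 1) ∣ pol (1 + X) (p₁ ++ φ^[k + 1] (tFactor c₁ m₁) ++ s₁)
      - pol (1 + X) (p₂ ++ φ^[k + 1] (tFactor c₂ m₂) ++ s₂)) :
    TypeEquiv (k + 1) (p₁, s₁) (p₂, s₂) := by
  induction k generalizing c₁ m₁ c₂ m₂ p₁ s₁ p₂ s₂ with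
  | zero =>
    obtain ⟨q₁, r₁, d₁, l₁, δ₁, δ₁', H₁⟩ := h₁.exists_half
    obtain ⟨q₂, r₂, d₂, l₂, δ₂, δ₂', H₂⟩ := h₂.exists_half
    -- Blocks of order 0 are letters, so nothing remains outside the cut.
    have nil : ∀ {w : Word}, w.length < 2 ^ 0 → w = [] := fun {w} hw =>
      List.length_eq_zero_iff.1 (by simpa using hw)
    obtain rfl := nil H₁.occ.left_lt
    obtain rfl := nil H₁.occ.right_lt
    obtain rfl := nil H₂.occ.left_lt
    obtain rfl := nil H₂.occ.right_lt
    rw [← H₁.word_eq, ← H₂.word_eq] at hlen hdvd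
    obtain rfl : l₁ = l₂ := by simpa using hlen
    exact H₁.typeEquiv H₂ (balance_eq_of_dvd (by simp) hdvd)
  | succ k ih =>
    obtain ⟨q₁, r₁, d₁, l₁, δ₁, δ₁', H₁⟩ := h₁.exists_half
    obtain ⟨q₂, r₂, d₂, l₂, δ₂, δ₂', H₂⟩ := h₂.exists_half
    rw [← H₁.word_eq] at hlen hdvd hn hn4
    rw [← H₂.word_eq] at hlen hdvd
    have hn' : 2 ^ (k + 1) ≤ (q₁ ++ φ^[k + 1] (tFactor d₁ l₁) ++ r₁).length + 1 :=
      (Nat.pow_le_pow_right (by norm_num) (by omega)).trans hn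
    have o₁ := H₁.occ
    have o₂ := H₂.occ
    have hT := ih o₁ o₂ hlen hn' hn4 ((pow_dvd_pow _ (by omega)).trans hdvd)
    obtain ⟨-, a, ⟨hl, h | h | h | h⟩ | ⟨-, h | h⟩⟩ := hT <;>
      simp only [Prod.mk.injEq, Nat.add_sub_cancel] at h
    · obtain ⟨rfl, rfl⟩ := h
      obtain rfl : l₁ = l₂ := by
        simpa only [List.length_append, length_φ_iterate, length_tFactor, add_left_inj,
          add_right_inj, mul_eq_mul_left_iff, pow_eq_zero_iff', OfNat.ofNat_ne_zero, false_and,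
          or_false] using hlen
      exact H₁.typeEquiv H₂ (balance_eq_of_dvd (by simp) hdvd)
    · obtain ⟨rfl, rfl⟩ := h
      exact (o₁.false_of_comm o₂ hlen hn hn4 hdvd).elim
    · obtain ⟨rfl, rfl⟩ := h
      exact (o₂.false_of_comm o₁ hlen.symm (hlen ▸ hn) (hlen ▸ hn4)
        ((dvd_sub_comm).1 hdvd)).elim
    · obtain ⟨⟨rfl, rfl⟩, rfl, rfl⟩ := h
      exact (o₁.false_of_swap hlen hn hdvd).elim
    · obtain ⟨rfl, rfl⟩ := h
      exact (o₁.false_of_around hlen hn hdvd).elim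
    · obtain ⟨rfl, rfl⟩ := h
      exact (o₂.false_of_around hlen.symm (hlen ▸ hn) ((dvd_sub_comm).1 hdvd)).elim

/-! ### Existence and uniqueness of factorizations. -/

section
variable {k i c m α β : ℕ}

lemma occ_of_cut (hα : i + α = 2 ^ k * c) (hα' : α < 2 ^ k) (hβ : β < 2 ^ k) :
    Occ k c m (tFactor i α) (tFactor (2 ^ k * (c + m)) β) := by
  refine ⟨?_, ?_, by simpa, by simpa⟩
  · rcases Nat.eq_zero_or_pos α with rfl | hpos
    · exact Or.inl rfl
    obtain ⟨c', rfl⟩ : ∃ c', c = c' + 1 := Nat.exists_eq_succ_of_ne_zero (by rintro rfl; omega)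
    refine Or.inr ⟨c', rfl, ?_⟩
    rw [φ_iterate_letter, show 2 ^ k = (2 ^ k - α) + α by omega, tFactor_add,
      ← show 2 ^ k = (2 ^ k - α) + α by omega,
      show 2 ^ k * c' + (2 ^ k - α) = i by rw [Nat.mul_succ] at hα; omega]
    exact List.suffix_append _ _
  · rw [φ_iterate_letter]
    obtain ⟨e, he⟩ := Nat.exists_eq_add_of_le hβ.le
    conv_rhs => rw [he, tFactor_add, ← he]
    exact List.prefix_append _ _

lemma tFactor_cut (hα : i + α = 2 ^ k * c) :
    tFactor i (α + 2 ^ k * m + β)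
      = tFactor i α ++ φ^[k] (tFactor c m) ++ tFactor (2 ^ k * (c + m)) β := by
  rw [tFactor_add, tFactor_add, φ_iterate_tFactor, hα, ← add_assoc, hα, mul_add]

end

lemma ne_φ_iterate_of_length_lt {k : ℕ} {w : Word} (a : Bool) (h : w.length < 2 ^ k) :
    w ≠ φ^[k] [a] := by
  rintro rfl
  simp at h

/-- A factorization of order `k` is a cut of an occurrence at its outer bars. -/
lemma IsFactorization.exists_occ {k : ℕ} {u : Word} {q : Word × Word} (h : IsFactorization k u q) :
    ∃ c m, Occ k c m q.1 q.2 ∧ u = q.1 ++ φ^[k] (tFactor c m) ++ q.2 := by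
  obtain ⟨p, s⟩ := q
  obtain ⟨C, ⟨-, i, hu, rfl⟩, ⟨⟨hpu, c, hc⟩, -⟩, ⟨M, ⟨⟨hM, c', hc'⟩, hmax⟩, hs⟩, ⟨w, hw⟩, hp', hs'⟩ :=
    h
  simp only [bar_eq] at hpu hc hM hc' hs hp' hs' hmax hw ⊢
  have hpos : 0 < 2 ^ k := by positivity
  have hpM : p.length ≤ M := hmax ⟨hpu, c, by rw [bar_eq, hc]⟩
  have hplt : p.length < 2 ^ k := by
    rcases hp' with rfl | ⟨a, h, hne⟩
    · exact hpos
    · simpa using h.length_le.lt_of_ne fun e => hne (h.eq_of_length e)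
  have hslt : s.length < 2 ^ k := by
    rcases hs' with rfl | ⟨a, h, hne⟩
    · exact hpos
    · simpa using h.length_le.lt_of_ne fun e => hne (h.eq_of_length e)
  obtain ⟨m, rfl⟩ : ∃ m, c' = c + m :=
    Nat.exists_eq_add_of_le (Nat.le_of_mul_le_mul_left (by omega) hpos)
  have hlen : u.length = p.length + 2 ^ k * m + s.length := by
    rw [mul_add] at hc'; omega
  have hu' := hu.symm.trans hw
  -- The cut of the occurrence has parts of the same lengths, so it coincides with the given
  -- factorization.
  rw [hlen, tFactor_cut hc.symm] at hu'
  obtain ⟨h₁, h₂⟩ := List.append_inj' hu' (by simp)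
  obtain ⟨h₃, -⟩ := List.append_inj h₁ (by simp)
  refine ⟨c, m, ?_, ?_⟩
  · have := occ_of_cut (m := m) hc.symm hplt hslt
    rwa [h₂, h₃] at this
  · have := hu
    rwa [hlen, tFactor_cut hc.symm, h₂, h₃] at this

lemma exists_isFactorization {k n : ℕ} (hn : 2 ^ k - 1 ≤ n) (i : ℕ) :
    ∃ q, IsFactorization k (tFactor i n) q := by
  have hpos : 0 < 2 ^ k := by positivity
  -- `α` is the distance from `i` to the next multiple of `2^k`, at most `2^k - 1`, hence within the
  -- word.
  obtain ⟨c, α, hα, hα'⟩ : ∃ c α, i + α = 2 ^ k * c ∧ α < 2 ^ k := by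
    have h := Nat.div_add_mod (i + (2 ^ k - 1)) (2 ^ k)
    have h' := Nat.mod_lt (i + (2 ^ k - 1)) hpos
    exact ⟨(i + (2 ^ k - 1)) / 2 ^ k, 2 ^ k - 1 - (i + (2 ^ k - 1)) % 2 ^ k, by omega, by omega⟩
  obtain ⟨m, β, rfl, hβ⟩ : ∃ m β, n = α + 2 ^ k * m + β ∧ β < 2 ^ k := by
    have h := Nat.div_add_mod (n - α) (2 ^ k)
    exact ⟨(n - α) / 2 ^ k, (n - α) % 2 ^ k, by omega, Nat.mod_lt _ hpos⟩
  have hmem : α ∈ {j | j ≤ (tFactor i (α + 2 ^ k * m + β)).length ∧ i + j ∈ Set.range (bar k)} :=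
    ⟨by rw [length_tFactor]; omega, c, by rw [bar_eq, hα]⟩
  have ho := occ_of_cut (m := m) hα hα' hβ
  refine ⟨(tFactor i α, tFactor (2 ^ k * (c + m)) β), _, ⟨⟨α, hmem⟩, i, by simp, rfl⟩,
    ⟨by simpa using hmem, ?_⟩, ⟨α + 2 ^ k * m, ⟨⟨by simp, c + m, ?_⟩, ?_⟩, by simp⟩,
    ⟨_, tFactor_cut hα⟩, ?_, ?_⟩
  · rintro j ⟨-, e, he⟩
    rw [bar_eq] at he
    rw [length_tFactor]
    have : c ≤ e := by
      by_contra h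
      have := Nat.mul_le_mul_left (2 ^ k) (show e + 1 ≤ c by omega)
      rw [mul_add] at this
      omega
    have := Nat.mul_le_mul_left (2 ^ k) this
    omega
  · rw [bar_eq, mul_add, ← hα]; ring
  · rintro j ⟨hj, e, he⟩
    rw [bar_eq] at he
    rw [length_tFactor] at hj
    have : e ≤ c + m := by
      by_contra h
      have := Nat.mul_le_mul_left (2 ^ k) (show c + m + 1 ≤ e by omega)
      rw [mul_add, mul_add] at this
      omega
    have := Nat.mul_le_mul_left (2 ^ k) this
    rw [mul_add] at this
    omega
  · rcases ho.left with h | ⟨c', -, h⟩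
    · exact Or.inl h
    · exact Or.inr ⟨_, h, ne_φ_iterate_of_length_lt _ ho.left_lt⟩
  · exact Or.inr ⟨_, ho.right, ne_φ_iterate_of_length_lt _ ho.right_lt⟩

/-- A factorization is determined by the length of its left part. -/
lemma IsFactorization.eq_of_length_eq {k : ℕ} {u : Word} {q q' : Word × Word}
    (h : IsFactorization k u q) (h' : IsFactorization k u q')
    (hl : q.1.length = q'.1.length) : q = q' := by
  obtain ⟨c, m, ho, hu⟩ := h.exists_occ
  obtain ⟨c', m', ho', hu'⟩ := h'.exists_occ
  have e := hu.symm.trans hu'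
  have hlen := congrArg List.length e
  simp only [List.length_append, length_φ_iterate, length_tFactor] at hlen
  -- The total length modulo `2^k` fixes the length of the right part.
  have hr : q.2.length = q'.2.length := by
    have h₁ : (2 ^ k * m + q.2.length) % 2 ^ k = (2 ^ k * m' + q'.2.length) % 2 ^ k := by
      congr 1; omega
    rwa [Nat.mul_add_mod, Nat.mul_add_mod, Nat.mod_eq_of_lt ho.right_lt,
      Nat.mod_eq_of_lt ho'.right_lt] at h₁
  obtain ⟨e₁, e₂⟩ := List.append_inj' e hr
  exact Prod.ext (List.append_inj e₁ hl).1 e₂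

lemma exists_isMinFactorization {k n : ℕ} (hn : 2 ^ k - 1 ≤ n) {u : Word} (hu : u ∈ Fac n) :
    ∃ q₀, IsFactorization k u q₀ ∧ ∀ q, IsMinFactorization k u q ↔ q = q₀ := by
  obtain ⟨i, rfl⟩ := hu
  let S : Set (Word × Word) := {q | IsFactorization k (tFactor i n) q}
  have hS : S.Nonempty := exists_isFactorization hn i
  let q₀ := Function.argminOn (fun q : Word × Word => q.1.length) S hS
  have h₀ : IsFactorization k (tFactor i n) q₀ := Function.argminOn_mem _ S hS
  have hmin : ∀ q, IsFactorization k (tFactor i n) q → q₀.1.length ≤ q.1.length := fun q hq =>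
    Function.argminOn_le (fun q : Word × Word => q.1.length) S hq
  refine ⟨q₀, h₀, fun q => ⟨fun h => ?_, ?_⟩⟩
  · exact h.1.eq_of_length_eq h₀ ((h.2 _ h₀).antisymm (hmin _ h.1))
  · rintro rfl
    exact ⟨h₀, hmin⟩

end ThueMorse

theorem mainTheorem2 (k : ℕ) (hk : 3 ≤ k) (n : ℕ) (hn : 2 ^ k - 1 ≤ n)
    (u v : ThueMorse.Word) (hu : u ∈ ThueMorse.Fac n) (hv : v ∈ ThueMorse.Fac n) :
    ∃ qu qv : ThueMorse.Word × ThueMorse.Word,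
      (∀ q, ThueMorse.IsMinFactorization k u q ↔ q = qu) ∧
      (∀ q, ThueMorse.IsMinFactorization k v q ↔ q = qv) ∧
      (ThueMorse.BinomEquiv k u v ↔ ThueMorse.TypeEquiv k qu qv) := by
  obtain ⟨qu, hqu, hqu'⟩ := ThueMorse.exists_isMinFactorization hn hu
  obtain ⟨qv, hqv, hqv'⟩ := ThueMorse.exists_isMinFactorization hn hv
  refine ⟨qu, qv, hqu', hqv', ?_⟩
  obtain ⟨c₁, m₁, ho₁, hu₁⟩ := hqu.exists_occ
  obtain ⟨c₂, m₂, ho₂, hv₂⟩ := hqv.exists_occ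
  have hul : u.length = n := by obtain ⟨i, rfl⟩ := hu; simp
  have hvl : v.length = n := by obtain ⟨i, rfl⟩ := hv; simp
  obtain ⟨k, rfl⟩ : ∃ j, k = j + 1 := ⟨k - 1, by omega⟩
  -- Order at least 3 makes the words longer than the 4 letters needed to exclude the exceptional
  -- word of length 3.
  have h8 : 2 ^ 3 ≤ 2 ^ (k + 1) := Nat.pow_le_pow_right (by norm_num) hk
  have hlen := hul.trans hvl.symm
  rw [hu₁] at hul
  rw [hu₁, hv₂] at hlen ⊢
  exact ⟨fun h => ho₁.typeEquiv_of_dvd ho₂ hlen (by omega) (by omega) h.X_pow_dvd,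
    ThueMorse.binomEquiv_of_typeEquiv hlen⟩
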